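/- **Model.** Let $m,n,q\ge 0$ be integers, $X\in\mathbb R^{m\times q}$, $\beta\in\mathbb R^q$, $A\in\mathbb R^{m\times n}$, $K\in\mathbb R^{n\times n}$ invertible, $h\in\mathbb R^n$, $\mu\in\mathbb R$, $\sigma>0$, $\sigma_\epsilon>0$, and let $(p,a,b)$ satisfy $a>0,b>0,p\in\mathbb R$, or $a=0,b>0,p<0$, or $a>0,b=0,p>0$. Consider $$Y\mid W,V\sim N(X\beta+AW,\sigma_\epsilon^2 I),\qquad KW\mid V\sim N(\mu V-\mu h,\operatorname{diag}(\sigma^2V)),\qquad V_1,\dots,V_n\ \text{independent},\ V_i\sim \mathrm{GIG}(p,a,b),$$ where $\mathrm{GIG}(p,a,b)$ has density on $(0,\infty)$ proportional to $x^{p-1}e^{-(ax+b/x)/2}$. Fix the observation $Y\in\mathbb R^m$. Let $\pi(dV)=\pi(V\mid Y)\,dV$ be the posterior law of $V$ on $\mathbb R^n_+=(0,\infty)^n$, and let $(V^{(t)})$ be the Markov chain on $\mathbb R^n_+$ of the Gibbs sampler, with transition density $$k(V,\tilde V)=\int_{\mathbb R^n}\pi(\tilde V\mid W,Y)\,\pi(W\mid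 V,Y)\,dW .$$ Let $L_2(\pi)$ be the real Hilbert space of (classes of) $\pi$-square integrable functions on $\mathbb R^n_+$, and $L_{2,0}(\pi)=\mathbf 1^\perp$ the orthogonal complement of the constants. For a probability measure $\nu$ on $\mathbb R^n_+$ write $\nu\Lambda^t$ for the law of $V^{(t)}$ when $V^{(0)}\sim\nu$, and let $\|\nu-\nu'\|_{\mathrm{TV}}=\sup_B|\nu(B)-\nu'(B)|$ over Borel sets $B$. **Proposition.** The formula $$(\Lambda f)(V)=\int_{\mathbb R^n_+}k(V,\tilde V)f(\tilde V)\,d\tilde V$$ (with the integral absolutely convergent for $\pi$-a.e. $V$) defines a bounded operator $\Lambda$ on $L_2(\pi)$. If $\Lambda$ is trace-class, i.e. its singular values are summable, then: 1. $\Lambda$ has a positive spectral gap at $1$: with $\Lambda_0:=\Lambda|_{L_{2,0}(\pi)}$, $$\lambda^\star:=1-\|\Lambda_0\|\in(0,1],$$ and there is $r<1$ such that $|\lambda|\le r$ for every $\lambda\in\operatorname{spec}(\Lambda)$ with $\lambda\ne1$. 2. The chain $(V^{(t)})$ is geometrically ergodic in $L_2(\pi)$: there is $\gamma\in(0,1)$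 such that for every probability measure $\nu\ll\pi$ with $d\nu/d\pi\in L_2(\pi)$ there is $C>0$ with $\|\nu\Lambda^t-\pi\|_{\mathrm{TV}}\le C\gamma^t$ for all $t\ge0$. 3. For every probability measure $\nu\ll\pi$ with $d\nu/d\pi\in L_2(\pi)$ there is a finite constant $C(\nu)$ such that $$\|\nu\Lambda^t-\pi\|_{\mathrm{TV}}\le C(\nu)\,(1-\lambda^\star)^t\qquad\text{for all integers } t\ge 0,$$ where $(1-\lambda^\star)^0=1$. -/

import Mathlib

open MeasureTheory ProbabilityTheory

noncomputable section

/-! ### Notions for a Markov chain on a general state space -/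

namespace MarkovL2

variable {α : Type*} [MeasurableSpace α]

/-- Total variation distance `sup_A |μ(A) - ν(A)|` (used here for probability measures only). -/
def tvDist (μ ν : Measure α) : ℝ :=
  ⨆ A : {A : Set α // MeasurableSet A}, |μ.real A.1 - ν.real A.1|

/-- The law `ν P ^ m` of the chain with transition kernel `P` after `m` steps, started from `ν`;
one step is `(ν P)(A) = ∫ P(x, A) dν(x)`. -/
def law (P : Kernel α α) (ν : Measure α) : ℕ → Measure α
  | 0 => ν
  | m + 1 => (law P ν m).bind P

/-- `ν` is a probability measure, absolutely continuous with respect to `π`, with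
`dν/dπ ∈ L²(π)`. -/
def IsL2Start (π ν : Measure α) : Prop :=
  IsProbabilityMeasure ν ∧ ν ≪ π ∧ MemLp (fun x => (ν.rnDeriv π x).toReal) 2 π

/-- Geometric ergodicity in `L²(π)`: one rate `γ ∈ (0, 1)` serves all initial probability measures
with square integrable density, the multiplicative constant may depend on the initial measure. -/
def GeometricallyErgodicL2 (P : Kernel α α) (π : Measure α) : Prop :=
  ∃ γ : ℝ, 0 < γ ∧ γ < 1 ∧ ∀ ν : Measure α, IsL2Start π ν →
    ∃ C : ℝ, 0 < C ∧ ∀ m : ℕ, tvDist (law P ν m) π ≤ C * γ ^ m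

/-- `L²₀(π)`, the orthogonal complement in `L²(π)` of (the class of) the constant function `1`. -/
def L2Zero (π : Measure α) : Submodule ℝ (Lp ℝ 2 π) :=
  (Submodule.span ℝ {g : Lp ℝ 2 π | g =ᵐ[π] fun _ => (1 : ℝ)})ᗮ

/-- The restriction `Λ₀` of `Λ` to `L²₀(π)`. -/
def restrictL2Zero {π : Measure α} (Λ : Lp ℝ 2 π →L[ℝ] Lp ℝ 2 π) :
    L2Zero π →L[ℝ] Lp ℝ 2 π :=
  Λ ∘L (L2Zero π).subtypeL

/-- `λ⋆ = 1 - ‖Λ₀‖`. -/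
def spectralGap {π : Measure α} (Λ : Lp ℝ 2 π →L[ℝ] Lp ℝ 2 π) : ℝ :=
  1 - ‖restrictL2Zero Λ‖

/-- A bounded operator on a Hilbert space is trace-class if its singular values are summable:
it has a singular value decomposition `T x = ∑ i, s i ⟪e i, x⟫ f i` with orthonormal families
`e`, `f` and summable positive singular values `s` (repeated according to multiplicity). There are
necessarily at most countably many of them, so that index types in `Type` suffice. -/
def IsTraceClass {H : Type*} [NormedAddCommGroup H] [InnerProductSpace ℝ H]
    (T : H →L[ℝ] H) : Prop :=
  ∃ (ι : Type) (s : ι → ℝ) (e f : ι → H),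
    (∀ i, 0 < s i) ∧ Summable s ∧ Orthonormal ℝ e ∧ Orthonormal ℝ f ∧
      ∀ x, HasSum (fun i => (s i * inner ℝ (e i) x) • f i) (T x)

end MarkovL2

/-! ### The linear latent non-Gaussian model and its Gibbs sampler -/

/-- The positive orthant of `ℝⁿ`, with the restriction of Lebesgue measure as `volume`. -/
abbrev PosOrthant (n : ℕ) : Type := {v : Fin n → ℝ // ∀ i, 0 < v i}

instance PosOrthant.measureSpace (n : ℕ) : MeasureSpace (PosOrthant n) :=
  Measure.Subtype.measureSpace

theorem PosOrthant.measurableSet (n : ℕ) : MeasurableSet {v : Fin n → ℝ | ∀ i, 0 < v i} := by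
  measurability

instance PosOrthant.sigmaFinite (n : ℕ) : SigmaFinite (volume : Measure (PosOrthant n)) := by
  have e : MeasurableEmbedding (Subtype.val : PosOrthant n → Fin n → ℝ) :=
    MeasurableEmbedding.subtype_coe (PosOrthant.measurableSet n)
  refine ⟨⟨⟨fun i => Subtype.val ⁻¹' spanningSets (volume : Measure (Fin n → ℝ)) i,
    fun _ => trivial, fun i => ?_, ?_⟩⟩⟩
  · change Measure.comap Subtype.val volume _ < ⊤
    rw [e.comap_apply]
    exact (measure_mono (Set.image_preimage_subset _ _)).trans_lt (measure_spanningSets_lt_top _ i)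
  · rw [← Set.preimage_iUnion, iUnion_spanningSets, Set.preimage_univ]

/-- The parameter space of the generalized inverse Gaussian (GIG) distributions: the interior case,
the inverse gamma boundary case and the gamma boundary case. -/
def IsGIGParam (p a b : ℝ) : Prop :=
  (0 < a ∧ 0 < b) ∨ (a = 0 ∧ 0 < b ∧ p < 0) ∨ (0 < a ∧ b = 0 ∧ 0 < p)

/-- The GIG kernel, i.e. the density on `(0, ∞)` up to normalization. -/
def gigKernel (p a b x : ℝ) : ℝ := x ^ (p - 1) * Real.exp (-(1 / 2) * (a * x + b / x))

/-- The density of `GIG(p, a, b)` at `x > 0`. For `a, b > 0` the normalizing integral is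
`2 K_p(√(a b)) (b / a) ^ (p / 2)`, where `K_p` is the modified Bessel function of the second kind;
the integral also covers the gamma and inverse gamma boundary cases. -/
def gigPDF (p a b x : ℝ) : ℝ := gigKernel p a b x / ∫ t in Set.Ioi (0 : ℝ), gigKernel p a b t

/-- The parameters and the observation of a linear latent non-Gaussian model with data in `ℝᵐ`,
latent field in `ℝⁿ` and `q` regression coefficients:
`Y | W, V ~ N(X β + A W, σε² I)`, `K W | V ~ N(μ V - μ h, diag(σ² V))`,
`V_i ~ GIG(p, a, b)` independently. -/
structure LLnGM (m n q : ℕ) where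
  X : Matrix (Fin m) (Fin q) ℝ
  β : Fin q → ℝ
  A : Matrix (Fin m) (Fin n) ℝ
  K : Matrix (Fin n) (Fin n) ℝ
  h : Fin n → ℝ
  μ : ℝ
  σ : ℝ
  σε : ℝ
  p : ℝ
  a : ℝ
  b : ℝ
  Y : Fin m → ℝ
  K_det_ne_zero : K.det ≠ 0
  σ_pos : 0 < σ
  σε_pos : 0 < σε
  gig_param : IsGIGParam p a b

namespace LLnGM

variable {m n q : ℕ} (M : LLnGM m n q)

/-- The density of `Y` given `W = w` (and `V`), at the observation: `N(X β + A w, σε² I)`. -/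
def likelihood (w : Fin n → ℝ) : ℝ :=
  ∏ j, gaussianPDFReal ((M.X.mulVec M.β) j + (M.A.mulVec w) j) (M.σε ^ 2).toNNReal (M.Y j)

/-- The density of `W` given `V = v`, where `K W | V ~ N(μ V - μ h, diag(σ² V))`. -/
def latentPDF (w : Fin n → ℝ) (v : PosOrthant n) : ℝ :=
  |M.K.det| * ∏ i, gaussianPDFReal (M.μ * v.1 i - M.μ * M.h i) (M.σ ^ 2 * v.1 i).toNNReal
    ((M.K.mulVec w) i)

/-- The density of `V`, with independent `GIG(p, a, b)` components. -/
def priorPDF (v : PosOrthant n) : ℝ := ∏ i, gigPDF M.p M.a M.b (v.1 i)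

/-- The joint density of `(Y, W, V)` at the observation, as a function of `W` and `V`. -/
def joint (w : Fin n → ℝ) (v : PosOrthant n) : ℝ :=
  M.likelihood w * M.latentPDF w v * M.priorPDF v

/-- The conditional density `π(W | V, Y)`. -/
def condW (w : Fin n → ℝ) (v : PosOrthant n) : ℝ := M.joint w v / ∫ w', M.joint w' v

/-- The conditional density `π(V | W, Y)`. -/
def condV (v : PosOrthant n) (w : Fin n → ℝ) : ℝ := M.joint w v / ∫ v', M.joint w v'

/-- The posterior density `π(V | Y)`. -/
def posteriorPDF (v : PosOrthant n) : ℝ := (∫ w, M.joint w v) / ∫ v', ∫ w, M.joint w v'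

/-- The posterior distribution `π` of `V` given `Y`. -/
def posterior : Measure (PosOrthant n) :=
  volume.withDensity fun v => ENNReal.ofReal (M.posteriorPDF v)

/-- The transition density `k(v, v') = ∫ π(v' | w, Y) π(w | v, Y) dw` of the `V`-chain of the Gibbs
sampler. -/
def k (v v' : PosOrthant n) : ℝ := ∫ w, M.condV v' w * M.condW w v

/-! Measurability of the transition density, needed to form the transition kernel. -/

theorem measurable_joint :
    Measurable fun z : (Fin n → ℝ) × PosOrthant n => M.joint z.1 z.2 := by
  have hV : ∀ i, Measurable fun z : (Fin n → ℝ) × PosOrthant n => z.2.1 i := fun i =>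
    (measurable_pi_apply i).comp (measurable_subtype_coe.comp measurable_snd)
  have hA : ∀ j, Measurable fun z : (Fin n → ℝ) × PosOrthant n => (M.A.mulVec z.1) j := fun j => by
    simp only [Matrix.mulVec, dotProduct]
    fun_prop
  have hK : ∀ j, Measurable fun z : (Fin n → ℝ) × PosOrthant n => (M.K.mulVec z.1) j := fun j => by
    simp only [Matrix.mulVec, dotProduct]
    fun_prop
  unfold joint likelihood latentPDF priorPDF gigPDF gigKernel gaussianPDFReal
  fun_prop

theorem measurable_k : Measurable (Function.uncurry M.k) := by
  have hj := M.measurable_joint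
  have h1 : Measurable fun w : Fin n → ℝ => ∫ v', M.joint w v' :=
    (StronglyMeasurable.integral_prod_right' hj.stronglyMeasurable).measurable
  have h2 : Measurable fun v : PosOrthant n => ∫ w', M.joint w' v :=
    (StronglyMeasurable.integral_prod_left' hj.stronglyMeasurable).measurable
  have h3 : Measurable fun z : (PosOrthant n × PosOrthant n) × (Fin n → ℝ) => M.joint z.2 z.1.2 :=
    Measurable.comp (g := fun y : (Fin n → ℝ) × PosOrthant n => M.joint y.1 y.2)
      (f := fun z : (PosOrthant n × PosOrthant n) × (Fin n → ℝ) => (z.2, z.1.2)) hj (by fun_prop)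
  have h4 : Measurable fun z : (PosOrthant n × PosOrthant n) × (Fin n → ℝ) => M.joint z.2 z.1.1 :=
    Measurable.comp (g := fun y : (Fin n → ℝ) × PosOrthant n => M.joint y.1 y.2)
      (f := fun z : (PosOrthant n × PosOrthant n) × (Fin n → ℝ) => (z.2, z.1.1)) hj (by fun_prop)
  have h5 : Measurable fun z : (PosOrthant n × PosOrthant n) × (Fin n → ℝ) =>
      M.condV z.1.2 z.2 * M.condW z.2 z.1.1 :=
    (h3.div (h1.comp measurable_snd)).mul (h4.div (h2.comp (measurable_fst.comp measurable_fst)))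
  exact (StronglyMeasurable.integral_prod_right' h5.stronglyMeasurable).measurable

/-- The transition kernel `P(v, dv') = k(v, v') dv'` of the `V`-chain. -/
def kernel : Kernel (PosOrthant n) (PosOrthant n) :=
  ⟨fun v => volume.withDensity fun v' => ENNReal.ofReal (M.k v v'), by
    refine Measure.measurable_of_measurable_coe _ fun s hs => ?_
    simp_rw [withDensity_apply _ hs]
    exact Measurable.lintegral_prod_right' (ENNReal.measurable_ofReal.comp M.measurable_k)⟩

/-- `Λ` is the operator `(Λ f)(v) = ∫ k(v, v') f(v') dv'` on `L²(π)`; the integral converges for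
almost every `v`. -/
def IsMarkovOperator (Λ : Lp ℝ 2 M.posterior →L[ℝ] Lp ℝ 2 M.posterior) : Prop :=
  ∀ f : Lp ℝ 2 M.posterior, ∀ᵐ v ∂M.posterior,
    Integrable (fun v' => M.k v v' * f v') ∧ Λ f v = ∫ v', M.k v v' * f v'

end LLnGM

end

/-! Write P for the transition kernel of the V-chain. The density of `π` times `k` is symmetric
(detailed balance), so `π` is invariant. Jensen's inequality in each law P(v, ·) then makes
integration against P a contraction of L²(π), and this is `Λ`.

The defect ‖f‖² - ‖Λ f‖² is the `π`-integral of the variance of f under P(v, ·). If it vanishes, f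
is a.e. constant under some P(v, ·). As `k` is positive almost everywhere, `π ≪ P(v, ·)`, so f is
`π`-a.e. constant (`exists_ae_eq_const`).

Summable singular values leave only finitely many in [1/2, 1). A right singular vector with value 1
is norm-preserved, hence constant, hence invisible on the complement of the constants. So ‖Λ₀‖ < 1
(`IsTraceClass.exists_contraction`); neither self-adjointness nor positivity of `Λ` enters.

The spectral bound follows by subtracting the projection onto constants
(`mem_spectrum_sub_idempotent`). The total variation bound follows by pairing dν/dπ with `Λ ^ t`
applied to a centred indicator (`tvDist_law_le`). What is specific to the model is positivity,
measurability and integrability of the joint density. -/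

namespace MarkovL2

/-! ### Trace-class contractions of a Hilbert space and spectra -/

section Hilbert

variable {H : Type*} [NormedAddCommGroup H] [InnerProductSpace ℝ H]

/-- Pythagoras for `f` and Bessel for `e`. The hypothesis bounds coefficients rather than `s i`, so
that indices with `inner ℝ (e i) x = 0` impose no condition on `s i`. -/
theorem norm_sum_smul_le_of_orthonormal {ι : Type*} {e f : ι → H} (he : Orthonormal ℝ e)
    (hf : Orthonormal ℝ f) {s : ι → ℝ} {r : ℝ} (hr : 0 ≤ r) (S : Finset ι) (x : H)
    (hs : ∀ i ∈ S, |s i * inner ℝ (e i) x| ≤ r * |inner ℝ (e i) x|) :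
    ‖∑ i ∈ S, (s i * inner ℝ (e i) x) • f i‖ ≤ r * ‖x‖ := by
  have hsq : ‖∑ i ∈ S, (s i * inner ℝ (e i) x) • f i‖ ^ 2
      = ∑ i ∈ S, (s i * inner ℝ (e i) x) ^ 2 := by
    rw [← real_inner_self_eq_norm_sq, hf.inner_sum]
    simp [sq]
  have hbessel : ∑ i ∈ S, (inner ℝ (e i) x) ^ 2 ≤ ‖x‖ ^ 2 := by
    simpa using he.sum_inner_products_le x (s := S)
  refine le_of_sq_le_sq ?_ (by positivity)
  calc _ = ∑ i ∈ S, (s i * inner ℝ (e i) x) ^ 2 := hsq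
    _ ≤ ∑ i ∈ S, r ^ 2 * (inner ℝ (e i) x) ^ 2 := by
      refine Finset.sum_le_sum fun i hi => ?_
      rw [← mul_pow, ← sq_abs, ← sq_abs (r * _), abs_mul r, abs_of_nonneg hr]
      exact pow_le_pow_left₀ (abs_nonneg _) (hs i hi) 2
    _ ≤ (r * ‖x‖) ^ 2 := by
      rw [← Finset.mul_sum, mul_pow]
      gcongr

/-- A trace-class contraction which is isometric only at multiples of `u` is a strict contraction,
uniformly, on the orthogonal complement of `u`. -/
theorem IsTraceClass.exists_contraction {T : H →L[ℝ] H} (hT : IsTraceClass T)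
    (hnorm : ∀ x, ‖T x‖ ≤ ‖x‖) (u : H) (hu : ∀ x, ‖T x‖ = ‖x‖ → ∃ c : ℝ, x = c • u) :
    ∃ r : ℝ, 0 ≤ r ∧ r < 1 ∧ ∀ x, inner ℝ u x = 0 → ‖T x‖ ≤ r * ‖x‖ := by
  classical
  obtain ⟨ι, s, e, f, hs0, hsum, he, hf, hsvd⟩ := hT
  have hTe : ∀ i, T (e i) = s i • f i := by
    intro i
    refine (hsvd (e i)).unique ?_
    convert hasSum_single i ?_ using 1
    · simp [he.1 i]
    · intro j hj
      simp [he.2 hj]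
  have hs1 : ∀ i, s i ≤ 1 := by
    intro i
    have := hnorm (e i)
    rwa [hTe, norm_smul, hf.1, he.1, mul_one, Real.norm_of_nonneg (hs0 i).le] at this
  -- A singular vector with value 1 is norm-preserved, hence a multiple of `u`.
  have hperp : ∀ x, inner ℝ u x = 0 → ∀ i, s i = 1 → inner ℝ (e i) x = 0 := by
    intro x hx i hi
    obtain ⟨c, hc⟩ := hu (e i) (by rw [hTe, hi, one_smul, hf.1, he.1])
    rw [hc, inner_smul_left, hx, mul_zero]
  have hfin : {i | ¬ s i < 1 / 2}.Finite :=
    hsum.tendsto_cofinite_zero.eventually (gt_mem_nhds (by norm_num : (0 : ℝ) < 1 / 2))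
  have hfin' : {i | 1 / 2 ≤ s i ∧ s i < 1}.Finite :=
    hfin.subset fun i hi => not_lt.2 hi.1
  -- The entry 1/2 dominates the small singular values and keeps the finite set nonempty; any number
  -- in (0, 1) would serve as threshold.
  obtain ⟨r, hr0, hr1, hr⟩ : ∃ r : ℝ, 1 / 2 ≤ r ∧ r < 1 ∧ ∀ i, s i < 1 → s i ≤ r := by
    have hne : (insert (1 / 2 : ℝ) (hfin'.toFinset.image s)).Nonempty := Finset.insert_nonempty _ _
    refine ⟨(insert (1 / 2 : ℝ) (hfin'.toFinset.image s)).max' hne, ?_, ?_, ?_⟩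
    · exact Finset.le_max' _ _ (Finset.mem_insert_self _ _)
    · rw [Finset.max'_lt_iff]
      intro y hy
      simp only [Finset.mem_insert, Finset.mem_image, Set.Finite.mem_toFinset,
        Set.mem_ofPred_eq] at hy
      rcases hy with rfl | ⟨i, hi, rfl⟩
      · norm_num
      · exact hi.2
    · intro i hi
      by_cases h : 1 / 2 ≤ s i
      · refine Finset.le_max' _ _ (Finset.mem_insert_of_mem (Finset.mem_image_of_mem _ ?_))
        simpa using ⟨by simpa using h, hi⟩
      · exact (not_le.1 h).le.trans (Finset.le_max' _ _ (Finset.mem_insert_self _ _))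
  have hr0' : 0 ≤ r := by linarith
  refine ⟨r, hr0', hr1, fun x hx => ?_⟩
  refine le_of_tendsto (hsvd x).norm (Filter.Eventually.of_forall fun S => ?_)
  refine norm_sum_smul_le_of_orthonormal he hf hr0' S x fun i _ => ?_
  rcases (hs1 i).lt_or_eq with h | h
  · rw [abs_mul, abs_of_pos (hs0 i)]
    exact mul_le_mul_of_nonneg_right (hr i h) (abs_nonneg _)
  · simp [hperp x hx i h]

end Hilbert

/-- If `E` is an idempotent with `T E = E = E T`, the spectrum of `T` is contained in the
union of `{1}` and the spectrum of `T - E`. -/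
theorem mem_spectrum_sub_idempotent {R : Type*} [Ring R] [Algebra ℝ R] {T E : R}
    (hE : E * E = E) (hTE : T * E = E) (hET : E * T = E) {z : ℝ} (hz : z ∈ spectrum ℝ T)
    (hz0 : z ≠ 0) (hz1 : z ≠ 1) : z ∈ spectrum ℝ (T - E) := by
  intro hB
  apply hz
  rw [spectrum.mem_resolventSet_iff] at hB ⊢
  obtain ⟨U, hU⟩ := hB
  have h1 : (algebraMap ℝ R z - (T - E)) * E = z • E := by
    rw [sub_mul, sub_mul, hTE, hE, sub_self, sub_zero, Algebra.smul_def]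
  have h2 : E * (algebraMap ℝ R z - (T - E)) = z • E := by
    rw [mul_sub, mul_sub, hET, hE, sub_self, sub_zero, Algebra.smul_def, Algebra.commutes]
  rw [← hU] at h1 h2
  have h3 : (↑U⁻¹ : R) * E = z⁻¹ • E := by
    rw [Units.inv_mul_eq_iff_eq_mul, mul_smul_comm, h1, smul_smul, inv_mul_cancel₀ hz0, one_smul]
  have h4 : E * (↑U⁻¹ : R) = z⁻¹ • E := by
    rw [Units.mul_inv_eq_iff_eq_mul, smul_mul_assoc, h2, smul_smul, inv_mul_cancel₀ hz0, one_smul]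
  have h5 : algebraMap ℝ R z - T = U - E := by rw [hU]; abel
  have hz1' : z - 1 ≠ 0 := sub_ne_zero.2 hz1
  have h6 : z⁻¹ / (z - 1) * z - z⁻¹ - z⁻¹ / (z - 1) = 0 := by field_simp; ring
  rw [h5, isUnit_iff_exists]
  -- On the range of `E`, `U` acts as z and `U - E` as z - 1, so the inverse of `U` has to be
  -- corrected there by 1/(z - 1) - 1/z = z⁻¹/(z - 1).
  refine ⟨↑U⁻¹ + (z⁻¹ / (z - 1)) • E, ?_, ?_⟩
  · rw [sub_mul, mul_add, mul_add, U.mul_inv, mul_smul_comm, mul_smul_comm, h1, h4, hE, smul_smul]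
    rw [add_sub_assoc, ← add_smul, ← sub_smul,
      show z⁻¹ / (z - 1) * z - (z⁻¹ + z⁻¹ / (z - 1)) = 0 by linarith, zero_smul, add_zero]
  · rw [mul_sub, add_mul, add_mul, U.inv_mul, smul_mul_assoc, smul_mul_assoc, h2, h3, hE, smul_smul]
    rw [add_sub_assoc, ← add_smul, ← sub_smul,
      show z⁻¹ / (z - 1) * z - (z⁻¹ + z⁻¹ / (z - 1)) = 0 by linarith, zero_smul, add_zero]

end MarkovL2

namespace MarkovL2

/-! ### Markov kernels acting on L² of an invariant measure -/

section Invariant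

variable {α : Type*} [MeasurableSpace α] {P : Kernel α α} {π : Measure α}

theorem integral_bind_kernel {β : Type*} [MeasurableSpace β] {κ : Kernel α β} {ν : Measure α}
    {f : β → ℝ} (hf : Integrable f (ν.bind κ)) :
    ∫ y, f y ∂(ν.bind κ) = ∫ x, ∫ y, f y ∂κ x ∂ν := by
  rw [Measure.comp_eq_comp_const_apply] at hf ⊢
  rw [Kernel.integral_comp hf, Kernel.const_apply]

theorem integrable_integral_kernel (hinv : P.Invariant π) {f : α → ℝ} (hf : Integrable f π) :
    Integrable (fun x => ∫ y, f y ∂P x) π := by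
  rw [← hinv.def, Measure.comp_eq_comp_const_apply] at hf
  simpa using hf.integral_comp

theorem integral_integral_kernel (hinv : P.Invariant π) {f : α → ℝ} (hf : Integrable f π) :
    ∫ x, ∫ y, f y ∂P x ∂π = ∫ x, f x ∂π := by
  have h := hf
  rw [← hinv.def] at h
  rw [← integral_bind_kernel h, hinv.def]

/-- Invariance makes `π` the mixture of the laws `P x`, so a `π`-null set is null for almost all of
them. This lets integration against `P` act on classes of functions. -/
theorem ae_ae_kernel (hinv : P.Invariant π) {p : α → Prop} (h : ∀ᵐ x ∂π, p x) :
    ∀ᵐ x ∂π, ∀ᵐ y ∂P x, p y := by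
  rw [← hinv.def] at h
  exact Measure.ae_ae_of_ae_comp h

theorem ae_memLp_kernel (hinv : P.Invariant π) {f : α → ℝ} (hf : MemLp f 2 π) :
    ∀ᵐ x ∂π, MemLp f 2 (P x) := by
  have h1 : ∀ᵐ x ∂π, Integrable (fun y => f y ^ 2) (P x) := by
    have h := hf.integrable_sq
    rw [← hinv.def] at h
    exact Measure.ae_integrable_of_integrable_comp h
  have h2 : ∀ᵐ x ∂π, AEStronglyMeasurable f (P x) := by
    filter_upwards [ae_ae_kernel hinv hf.1.ae_eq_mk] with x hx
    exact ⟨_, hf.1.stronglyMeasurable_mk, hx⟩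
  filter_upwards [h1, h2] with x hx1 hx2
  exact (memLp_two_iff_integrable_sq hx2).2 hx1

/-- Jensen's inequality for the square with its defect made explicit: the variance is what decides
the equality case. -/
theorem sq_integral_add_variance {μ : Measure α} [IsProbabilityMeasure μ] {f : α → ℝ}
    (hf : MemLp f 2 μ) : (∫ y, f y ∂μ) ^ 2 + Var[f; μ] = ∫ y, f y ^ 2 ∂μ := by
  rw [variance_eq_sub hf]
  simp

theorem memLp_integral_kernel [IsMarkovKernel P] (hinv : P.Invariant π) {f : α → ℝ} (hf : MemLp f 2 π) :
    MemLp (fun x => ∫ y, f y ∂P x) 2 π := by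
  have hm : AEStronglyMeasurable (fun x => ∫ y, f y ∂P x) π := by
    refine ⟨fun x => ∫ y, hf.1.mk f y ∂P x, hf.1.stronglyMeasurable_mk.integral_kernel, ?_⟩
    filter_upwards [ae_ae_kernel hinv hf.1.ae_eq_mk] with x hx using integral_congr_ae hx
  rw [memLp_two_iff_integrable_sq hm]
  refine (integrable_integral_kernel hinv hf.integrable_sq).mono' (hm.pow 2) ?_
  filter_upwards [ae_memLp_kernel hinv hf] with x hx
  rw [Real.norm_of_nonneg (sq_nonneg _), ← sq_integral_add_variance hx]
  exact le_add_of_nonneg_right (variance_nonneg _ _)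

theorem integral_sq_integral_kernel_le [IsMarkovKernel P] (hinv : P.Invariant π) {f : α → ℝ} (hf : MemLp f 2 π) :
    ∫ x, (∫ y, f y ∂P x) ^ 2 ∂π ≤ ∫ x, f x ^ 2 ∂π := by
  rw [← integral_integral_kernel hinv hf.integrable_sq]
  refine integral_mono_ae (memLp_integral_kernel hinv hf).integrable_sq
    (integrable_integral_kernel hinv hf.integrable_sq) ?_
  filter_upwards [ae_memLp_kernel hinv hf] with x hx
  rw [← sq_integral_add_variance hx]
  exact le_add_of_nonneg_right (variance_nonneg _ _)

/-- Strict Jensen inequality for a kernel whose transition laws dominate `π`. -/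
theorem exists_ae_eq_const [IsMarkovKernel P] [NeZero π] (hinv : P.Invariant π) (hdom : ∀ x, π ≪ P x) {f : α → ℝ}
    (hf : MemLp f 2 π) (heq : ∫ x, (∫ y, f y ∂P x) ^ 2 ∂π = ∫ x, f x ^ 2 ∂π) :
    ∃ c : ℝ, f =ᵐ[π] fun _ => c := by
  have h1 := (memLp_integral_kernel hinv hf).integrable_sq
  have h2 := integrable_integral_kernel hinv hf.integrable_sq
  have h3 : ∫ x, ((∫ y, f y ^ 2 ∂P x) - (∫ y, f y ∂P x) ^ 2) ∂π = 0 := by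
    rw [integral_sub h2 h1, heq, integral_integral_kernel hinv hf.integrable_sq, sub_self]
  rw [integral_eq_zero_iff_of_nonneg_ae (f := fun x => (∫ y, f y ^ 2 ∂P x) - (∫ y, f y ∂P x) ^ 2)
    _ (h2.sub h1)] at h3
  -- One point with vanishing variance suffices, since `hdom` carries the a.e. equality from `P x`
  -- to `π`.
  · obtain ⟨x, hx, hx'⟩ := (h3.and (ae_memLp_kernel hinv hf)).exists
    refine ⟨∫ y, f y ∂P x, (hdom x).ae_le ?_⟩
    refine ae_eq_integral_of_variance_eq_zero hx' ?_
    have := sq_integral_add_variance hx'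
    simp only [Pi.zero_apply] at hx
    linarith
  · filter_upwards [ae_memLp_kernel hinv hf] with x hx
    simp only [Pi.zero_apply]
    rw [← sq_integral_add_variance hx, add_sub_cancel_left]
    exact variance_nonneg _ _

/-- `T` acts on `L²(π)` by integration against the transition laws of `P`. -/
def IsKernelOperator (P : Kernel α α) (T : Lp ℝ 2 π →L[ℝ] Lp ℝ 2 π) : Prop :=
  ∀ f : Lp ℝ 2 π, T f =ᵐ[π] fun x => ∫ y, f y ∂P x

theorem norm_sq_eq_integral (f : Lp ℝ 2 π) : ‖f‖ ^ 2 = ∫ x, f x ^ 2 ∂π := by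
  rw [← real_inner_self_eq_norm_sq, L2.inner_def]
  simp [sq]

theorem exists_isKernelOperator [IsMarkovKernel P] (hinv : P.Invariant π) :
    ∃ T : Lp ℝ 2 π →L[ℝ] Lp ℝ 2 π, IsKernelOperator P T := by
  have hL : ∀ f : Lp ℝ 2 π, MemLp (fun x => ∫ y, f y ∂P x) 2 π := fun f =>
    memLp_integral_kernel hinv (Lp.memLp f)
  refine ⟨LinearMap.mkContinuous
    { toFun := fun f => (hL f).toLp _
      map_add' := fun f g => ?_
      map_smul' := fun c f => ?_ } 1 fun f => ?_, fun f => ?_⟩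
  · rw [← MemLp.toLp_add, MemLp.toLp_eq_toLp_iff]
    filter_upwards [ae_ae_kernel hinv (Lp.coeFn_add f g), ae_memLp_kernel hinv (Lp.memLp f),
      ae_memLp_kernel hinv (Lp.memLp g)] with x hx hf hg
    rw [integral_congr_ae hx]
    exact integral_add (hf.integrable one_le_two) (hg.integrable one_le_two)
  · rw [RingHom.id_apply, ← MemLp.toLp_const_smul, MemLp.toLp_eq_toLp_iff]
    filter_upwards [ae_ae_kernel hinv (Lp.coeFn_smul c f)] with x hx
    rw [integral_congr_ae hx]
    exact integral_const_mul _ _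
  · rw [one_mul]
    refine le_of_sq_le_sq ?_ (norm_nonneg _)
    rw [norm_sq_eq_integral, norm_sq_eq_integral]
    refine (integral_congr_ae ?_).trans_le (integral_sq_integral_kernel_le hinv (Lp.memLp f))
    filter_upwards [MemLp.coeFn_toLp (hL f)] with x hx
    exact congrArg (· ^ 2) hx
  · exact MemLp.coeFn_toLp (hL f)

theorem IsKernelOperator.norm_sq {T : Lp ℝ 2 π →L[ℝ] Lp ℝ 2 π} (hT : IsKernelOperator P T)
    (f : Lp ℝ 2 π) : ‖T f‖ ^ 2 = ∫ x, (∫ y, f y ∂P x) ^ 2 ∂π := by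
  rw [norm_sq_eq_integral]
  refine integral_congr_ae ?_
  filter_upwards [hT f] with x hx
  rw [hx]

theorem IsKernelOperator.norm_le [IsMarkovKernel P] {T : Lp ℝ 2 π →L[ℝ] Lp ℝ 2 π} (hT : IsKernelOperator P T)
    (hinv : P.Invariant π) (f : Lp ℝ 2 π) : ‖T f‖ ≤ ‖f‖ := by
  refine le_of_sq_le_sq ?_ (norm_nonneg _)
  rw [hT.norm_sq, norm_sq_eq_integral]
  exact integral_sq_integral_kernel_le hinv (Lp.memLp f)

theorem norm_map_le_of_mem (T : Lp ℝ 2 π →L[ℝ] Lp ℝ 2 π) {f : Lp ℝ 2 π} (hf : f ∈ L2Zero π) :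
    ‖T f‖ ≤ ‖restrictL2Zero T‖ * ‖f‖ :=
  (restrictL2Zero T).le_opNorm ⟨f, hf⟩

variable [IsProbabilityMeasure π]

/-- The constant function `1` as an element of `L²(π)`. -/
noncomputable def oneL2 (π : Measure α) [IsProbabilityMeasure π] : Lp ℝ 2 π := Lp.const 2 π (1 : ℝ)

theorem coeFn_oneL2 : oneL2 π =ᵐ[π] fun _ => (1 : ℝ) := Lp.coeFn_const 2 π 1

theorem inner_oneL2 (f : Lp ℝ 2 π) : inner ℝ (oneL2 π) f = ∫ x, f x ∂π := by
  rw [L2.inner_def]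
  refine integral_congr_ae ?_
  filter_upwards [coeFn_oneL2 (π := π)] with x hx
  simp [hx]

theorem mem_L2Zero {f : Lp ℝ 2 π} : f ∈ L2Zero π ↔ inner ℝ (oneL2 π) f = 0 := by
  have : {g : Lp ℝ 2 π | g =ᵐ[π] fun _ => (1 : ℝ)} = {oneL2 π} := by
    ext g
    exact ⟨fun h => Lp.ext (Filter.EventuallyEq.trans h coeFn_oneL2.symm), fun h => by
      rw [Set.mem_singleton_iff.1 h]; exact coeFn_oneL2⟩
  rw [L2Zero, this, Submodule.mem_orthogonal_singleton_iff_inner_right]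

theorem norm_oneL2 : ‖oneL2 π‖ = 1 := by
  have h : ‖oneL2 π‖ ^ 2 = 1 := by
    rw [← real_inner_self_eq_norm_sq, inner_oneL2, integral_congr_ae coeFn_oneL2]
    simp
  exact (pow_eq_one_iff_of_nonneg (norm_nonneg _) two_ne_zero).1 h

namespace IsKernelOperator

variable {T : Lp ℝ 2 π →L[ℝ] Lp ℝ 2 π}

theorem map_one [IsMarkovKernel P] (hT : IsKernelOperator P T) (hinv : P.Invariant π) : T (oneL2 π) = oneL2 π := by
  refine Lp.ext ((hT _).trans (Filter.EventuallyEq.trans ?_ coeFn_oneL2.symm))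
  filter_upwards [ae_ae_kernel hinv (coeFn_oneL2 (π := π))] with x hx
  rw [integral_congr_ae hx]
  simp

theorem inner_one_map (hT : IsKernelOperator P T) (hinv : P.Invariant π) (f : Lp ℝ 2 π) :
    inner ℝ (oneL2 π) (T f) = inner ℝ (oneL2 π) f := by
  rw [inner_oneL2, inner_oneL2, integral_congr_ae (hT f),
    integral_integral_kernel hinv ((Lp.memLp f).integrable one_le_two)]

theorem eq_smul_one_of_norm_eq [IsMarkovKernel P] (hT : IsKernelOperator P T) (hinv : P.Invariant π)
    (hdom : ∀ x, π ≪ P x) {f : Lp ℝ 2 π} (hf : ‖T f‖ = ‖f‖) : ∃ c : ℝ, f = c • oneL2 π := by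
  have h : ‖T f‖ ^ 2 = ‖f‖ ^ 2 := by rw [hf]
  rw [hT.norm_sq, norm_sq_eq_integral] at h
  obtain ⟨c, hc⟩ := exists_ae_eq_const hinv hdom (Lp.memLp f) h
  refine ⟨c, Lp.ext (hc.trans ?_)⟩
  filter_upwards [Lp.coeFn_smul c (oneL2 π), coeFn_oneL2 (π := π)] with x h1 h2
  rw [h1, Pi.smul_apply, h2]
  simp

/-- A trace-class Markov operator with dominating transition laws has a spectral gap. -/
theorem spectralGap_pos [IsMarkovKernel P] (hT : IsKernelOperator P T) (hinv : P.Invariant π)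
    (hdom : ∀ x, π ≪ P x) (htc : IsTraceClass T) : 0 < spectralGap T := by
  obtain ⟨r, hr0, hr1, hr⟩ := htc.exists_contraction (hT.norm_le hinv) (oneL2 π)
    fun f hf => hT.eq_smul_one_of_norm_eq hinv hdom hf
  have : ‖restrictL2Zero T‖ ≤ r :=
    ContinuousLinearMap.opNorm_le_bound _ hr0 fun f => hr f (mem_L2Zero.1 f.2)
  unfold spectralGap
  linarith

/-- `restrictL2Zero T` takes values in all of L²(π) and cannot itself be iterated; the induction
therefore also carries that `T` preserves `L2Zero π`, which is invariance of `π`. -/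
theorem norm_pow_map_le (hT : IsKernelOperator P T) (hinv : P.Invariant π) {f : Lp ℝ 2 π}
    (hf : f ∈ L2Zero π) (t : ℕ) :
    ‖(T ^ t) f‖ ≤ ‖restrictL2Zero T‖ ^ t * ‖f‖ := by
  suffices (T ^ t) f ∈ L2Zero π ∧ ‖(T ^ t) f‖ ≤ ‖restrictL2Zero T‖ ^ t * ‖f‖ from this.2
  induction t with
  | zero => simpa using hf
  | succ t ih =>
    rw [pow_succ', mul_apply_eq_comp]
    refine ⟨mem_L2Zero.2 (by rw [hT.inner_one_map hinv, mem_L2Zero.1 ih.1]), ?_⟩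
    refine (norm_map_le_of_mem T ih.1).trans ?_
    rw [pow_succ', mul_assoc]
    gcongr
    exact ih.2

theorem sub_mem_L2Zero (f : Lp ℝ 2 π) : f - (inner ℝ (oneL2 π) f : ℝ) • oneL2 π ∈ L2Zero π := by
  rw [mem_L2Zero, inner_sub_right, inner_smul_right, real_inner_self_eq_norm_sq, norm_oneL2]
  simp

theorem norm_sub_le (f : Lp ℝ 2 π) : ‖f - (inner ℝ (oneL2 π) f : ℝ) • oneL2 π‖ ≤ ‖f‖ := by
  refine le_of_sq_le_sq ?_ (norm_nonneg _)
  rw [norm_sub_sq_real, norm_smul, norm_oneL2, inner_smul_right, real_inner_comm, mul_one,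
    Real.norm_eq_abs, sq_abs]
  nlinarith [sq_nonneg (inner ℝ (oneL2 π) f : ℝ)]

/-- With `E` the projection onto constants, `T - E` sends f to `T` of its centred part, so its norm
is at most that of the restriction and bounds its spectrum. The value 0 is treated apart because the
idempotent lemma excludes it. -/
theorem abs_le_of_mem_spectrum [IsMarkovKernel P] (hT : IsKernelOperator P T) (hinv : P.Invariant π) {z : ℝ}
    (hz : z ∈ spectrum ℝ T) (hz1 : z ≠ 1) : |z| ≤ ‖restrictL2Zero T‖ := by
  by_cases hz0 : z = 0
  · rw [hz0, abs_zero]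
    exact (restrictL2Zero T).opNorm_nonneg
  set E : Lp ℝ 2 π →L[ℝ] Lp ℝ 2 π := (innerSL ℝ (oneL2 π)).smulRight (oneL2 π) with hE
  have hEa : ∀ f, E f = (inner ℝ (oneL2 π) f : ℝ) • oneL2 π := fun f => by simp [hE]
  have h := mem_spectrum_sub_idempotent (T := T) (E := E)
    (by ext1 f; rw [mul_apply_eq_comp, hEa, hEa, inner_smul_right,
          real_inner_self_eq_norm_sq, norm_oneL2]; simp)
    (by ext1 f; rw [mul_apply_eq_comp, hEa, map_smul, hT.map_one hinv])
    (by ext1 f; rw [mul_apply_eq_comp, hEa, hEa, hT.inner_one_map hinv]) hz hz0 hz1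
  have : Nontrivial (Lp ℝ 2 π) := ⟨oneL2 π, 0, fun h0 => by
    have := norm_oneL2 (π := π)
    rw [h0, norm_zero] at this
    exact zero_ne_one this⟩
  refine (spectrum.norm_le_norm_of_mem h).trans ?_
  refine ContinuousLinearMap.opNorm_le_bound _ (restrictL2Zero T).opNorm_nonneg fun f => ?_
  have h1 : (T - E) f = T (f - (inner ℝ (oneL2 π) f : ℝ) • oneL2 π) := by
    rw [sub_apply, hEa, map_sub, map_smul, hT.map_one hinv]
  rw [h1]
  refine (norm_map_le_of_mem T (sub_mem_L2Zero f)).trans ?_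
  gcongr
  exact norm_sub_le f

end IsKernelOperator

/-! ### Convergence in total variation -/

section Convergence

variable {T : Lp ℝ 2 π →L[ℝ] Lp ℝ 2 π} {ν : Measure α}

theorem isProbabilityMeasure_law (P : Kernel α α) [IsMarkovKernel P] (ν : Measure α)
    [IsProbabilityMeasure ν] (t : ℕ) : IsProbabilityMeasure (law P ν t) := by
  induction t with
  | zero => assumption
  | succ t ih => exact inferInstanceAs (IsProbabilityMeasure ((law P ν t).bind P))

theorem memLp_two_of_bounded {u : α → ℝ} (hu : Measurable u) {C : ℝ} (hC : ∀ x, |u x| ≤ C) :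
    MemLp u 2 π :=
  MemLp.of_bound hu.aestronglyMeasurable C (Filter.Eventually.of_forall hC)

/-- Duality: evolving the measure is evolving the test function. The induction peels off the last
step of the chain and replaces `u` by its image under `P`, hence the generalization over `u`. -/
theorem IsKernelOperator.integral_law [IsMarkovKernel P] (hT : IsKernelOperator P T) (hinv : P.Invariant π)
    (hν : IsL2Start π ν) (t : ℕ) {u : α → ℝ} (hu : Measurable u) {C : ℝ} (hC : ∀ x, |u x| ≤ C) :
    ∫ x, u x ∂law P ν t
      = inner ℝ (hν.2.2.toLp _) ((T ^ t) ((memLp_two_of_bounded (π := π) hu hC).toLp u)) := by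
  have := hν.1
  induction t generalizing u with
  | zero =>
    rw [pow_zero, one_apply_eq_self, L2.inner_def]
    change ∫ x, u x ∂ν = _
    rw [← integral_toReal_rnDeriv_mul hν.2.1]
    refine integral_congr_ae ?_
    filter_upwards [hν.2.2.coeFn_toLp, (memLp_two_of_bounded (π := π) hu hC).coeFn_toLp]
      with x h1 h2
    rw [h1, h2]
    simp [mul_comm]
  | succ t ih =>
    have := isProbabilityMeasure_law P ν (t + 1)
    have hint : Integrable u ((law P ν t).bind P) :=
      Integrable.of_bound (μ := law P ν (t + 1)) hu.aestronglyMeasurable C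
        (Filter.Eventually.of_forall hC)
    have hu' : Measurable fun x => ∫ y, u y ∂P x :=
      hu.stronglyMeasurable.integral_kernel.measurable
    have hC' : ∀ x, |∫ y, u y ∂P x| ≤ C := fun x => by
      simpa using norm_integral_le_of_norm_le_const (μ := P x) (f := u) (C := C)
        (Filter.Eventually.of_forall hC)
    change ∫ x, u x ∂((law P ν t).bind P) = _
    rw [integral_bind_kernel hint, ih hu' hC', pow_succ, mul_apply_eq_comp]
    congr 2
    refine Lp.ext (((memLp_two_of_bounded (π := π) hu' hC').coeFn_toLp).trans ?_)
    filter_upwards [hT ((memLp_two_of_bounded (π := π) hu hC).toLp u),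
      ae_ae_kernel hinv (memLp_two_of_bounded (π := π) hu hC).coeFn_toLp] with x h1 h2
    rw [h1, integral_congr_ae h2]

/-- The density `g` pairs to 1 with the constant 1, which `T` fixes, so the difference on `A` is `g`
paired with `T ^ t` of the centred indicator. Cauchy–Schwarz gives a bound free of `A`. -/
theorem IsKernelOperator.tvDist_law_le [IsMarkovKernel P] (hT : IsKernelOperator P T) (hinv : P.Invariant π)
    (hν : IsL2Start π ν) (t : ℕ) :
    tvDist (law P ν t) π
      ≤ ‖hν.2.2.toLp (fun x => (ν.rnDeriv π x).toReal)‖ * ‖restrictL2Zero T‖ ^ t := by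
  have := hν.1
  have hprob := isProbabilityMeasure_law P ν t
  have : Nonempty {A : Set α // MeasurableSet A} := ⟨⟨∅, MeasurableSet.empty⟩⟩
  refine ciSup_le fun ⟨A, hA⟩ => ?_
  have hu : Measurable (A.indicator fun _ => (1 : ℝ)) := measurable_const.indicator hA
  have hC : ∀ x, |A.indicator (fun _ => (1 : ℝ)) x| ≤ 1 := fun x => by
    by_cases hx : x ∈ A <;> simp [hx]
  set ψ := (memLp_two_of_bounded (π := π) hu hC).toLp _ with hψ
  set g := hν.2.2.toLp (fun x => (ν.rnDeriv π x).toReal) with hg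
  have hψae : ψ =ᵐ[π] A.indicator fun _ => (1 : ℝ) := MemLp.coeFn_toLp _
  have h1 : (law P ν t).real A = inner ℝ g ((T ^ t) ψ) := by
    rw [← hT.integral_law hinv hν t hu hC, integral_indicator_const _ hA, smul_eq_mul, mul_one]
  have h2 : π.real A = inner ℝ (oneL2 π) ψ := by
    rw [inner_oneL2, integral_congr_ae hψae, integral_indicator_const _ hA, smul_eq_mul, mul_one]
  have hone : (T ^ t) (oneL2 π) = oneL2 π := by
    induction t with
    | zero => simp
    | succ t ih =>
      rw [pow_succ, mul_apply_eq_comp, hT.map_one hinv]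
      exact ih (isProbabilityMeasure_law P ν t) (by
        rw [← hT.integral_law hinv hν t hu hC, integral_indicator_const _ hA, smul_eq_mul, mul_one])
  have hg1 : inner ℝ g (oneL2 π) = 1 := by
    rw [real_inner_comm, inner_oneL2, integral_congr_ae hν.2.2.coeFn_toLp,
      Measure.integral_toReal_rnDeriv hν.2.1]
    simp
  have hψ1 : ‖ψ‖ ≤ 1 := by
    refine le_of_sq_le_sq ?_ zero_le_one
    rw [norm_sq_eq_integral]
    calc ∫ x, ψ x ^ 2 ∂π = ∫ x, A.indicator (fun _ => (1 : ℝ)) x ∂π := by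
          refine integral_congr_ae ?_
          filter_upwards [hψae] with x hx
          rw [hx]
          by_cases h : x ∈ A <;> simp [h]
      _ = π.real A := by rw [integral_indicator_const _ hA, smul_eq_mul, mul_one]
      _ ≤ 1 ^ 2 := by rw [one_pow]; exact measureReal_le_one
  have h3 : (law P ν t).real A - π.real A
      = inner ℝ g ((T ^ t) (ψ - (inner ℝ (oneL2 π) ψ : ℝ) • oneL2 π)) := by
    rw [map_sub, map_smul, hone, inner_sub_right, inner_smul_right, hg1, mul_one, h1, h2]
  rw [h3]
  calc _ ≤ ‖g‖ * ‖(T ^ t) (ψ - (inner ℝ (oneL2 π) ψ : ℝ) • oneL2 π)‖ := abs_real_inner_le_norm _ _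
    _ ≤ ‖g‖ * (‖restrictL2Zero T‖ ^ t * 1) := by
      gcongr
      refine (hT.norm_pow_map_le hinv (IsKernelOperator.sub_mem_L2Zero ψ) t).trans ?_
      gcongr
      exact (IsKernelOperator.norm_sub_le ψ).trans hψ1
    _ = _ := by rw [mul_one]

theorem IsKernelOperator.geometricallyErgodicL2 [IsMarkovKernel P] (hT : IsKernelOperator P T) (hinv : P.Invariant π)
    (hgap : 0 < spectralGap T) : GeometricallyErgodicL2 P π := by
  have h1 : ‖restrictL2Zero T‖ < 1 := by unfold spectralGap at hgap; linarith
  -- The rate must be positive while the norm may vanish, hence the maximum; the summand 1 makes the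
  -- constant visibly positive.
  refine ⟨max ‖restrictL2Zero T‖ (1 / 2), lt_max_of_lt_right (by norm_num),
    max_lt h1 (by norm_num), fun ν hν => ⟨‖hν.2.2.toLp (fun x => (ν.rnDeriv π x).toReal)‖ + 1,
      by positivity, fun t => (hT.tvDist_law_le hinv hν t).trans ?_⟩⟩
  gcongr
  · linarith
  · exact le_max_left _ _

end Convergence

end Invariant

end MarkovL2

/-! ### Detailed balance implies invariance -/

namespace MarkovL2

/-- A kernel with a density which is in detailed balance with the density of `π` leaves `π`
invariant. -/
theorem invariant_of_detailed_balance {α : Type*} [MeasurableSpace α] {μ : Measure α} [SFinite μ]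
    {P : Kernel α α} {k : α → α → ℝ} {p : α → ℝ} (hk : Measurable (Function.uncurry k))
    (hp : Measurable p) (hp0 : ∀ v, 0 ≤ p v)
    (hP : ∀ v, P v = μ.withDensity fun v' => ENNReal.ofReal (k v v'))
    (hk1 : ∀ v, ∫⁻ v', ENNReal.ofReal (k v v') ∂μ = 1) (hrev : ∀ v v', p v * k v v' = p v' * k v' v) :
    P.Invariant (μ.withDensity fun v => ENNReal.ofReal (p v)) := by
  have hkm : Measurable fun z : α × α => ENNReal.ofReal (k z.1 z.2) :=
    ENNReal.measurable_ofReal.comp hk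
  have hkv : ∀ v, Measurable fun v' => ENNReal.ofReal (k v v') := fun v =>
    hkm.comp measurable_prodMk_left
  have hpm : Measurable fun v => ENNReal.ofReal (p v) := ENNReal.measurable_ofReal.comp hp
  refine Measure.ext fun s hs => ?_
  rw [Measure.bind_apply hs P.aemeasurable, lintegral_withDensity_eq_lintegral_mul _ hpm
    (P.measurable_coe hs), withDensity_apply _ hs]
  calc ∫⁻ v, ENNReal.ofReal (p v) * P v s ∂μ
      = ∫⁻ v, ∫⁻ v' in s, ENNReal.ofReal (p v') * ENNReal.ofReal (k v' v) ∂μ ∂μ := by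
        refine lintegral_congr fun v => ?_
        rw [hP, withDensity_apply _ hs, ← lintegral_const_mul _ (hkv _)]
        refine lintegral_congr fun v' => ?_
        rw [← ENNReal.ofReal_mul (hp0 v), ← ENNReal.ofReal_mul (hp0 v'), hrev]
    _ = ∫⁻ v' in s, ∫⁻ v, ENNReal.ofReal (p v') * ENNReal.ofReal (k v' v) ∂μ ∂μ := by
        refine lintegral_lintegral_swap (Measurable.aemeasurable ?_)
        exact (hpm.comp measurable_snd).mul (hkm.comp measurable_swap)
    _ = ∫⁻ v' in s, ENNReal.ofReal (p v') ∂μ := by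
        refine lintegral_congr fun v' => ?_
        rw [lintegral_const_mul _ (hkv _), hk1, mul_one]

end MarkovL2

/-! ### Data augmentation: the marginal chain of a two-component Gibbs sampler -/

namespace DataAugmentation

variable {α β : Type*} [MeasurableSpace α] [MeasurableSpace β]

/-- The transition density `∫ j(w, v') / (∫ j(w, u) du) * j(w, v) / (∫ j(w', v) dw') dw`. -/
noncomputable def transPDF (j : β → α → ℝ) (μ : Measure α) (η : Measure β) (v v' : α) : ℝ :=
  ∫ w, (j w v' / ∫ u, j w u ∂μ) * (j w v / ∫ w', j w' v ∂η) ∂η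

/-- The marginal density of `v`. -/
noncomputable def marginalPDF (j : β → α → ℝ) (μ : Measure α) (η : Measure β) (v : α) : ℝ :=
  (∫ w, j w v ∂η) / ∫ v', ∫ w, j w v' ∂η ∂μ

variable {j : β → α → ℝ} {μ : Measure α} {η : Measure β}

theorem integral_pos_of_pos {γ : Type*} [MeasurableSpace γ] {ρ : Measure γ} [NeZero ρ] {f : γ → ℝ}
    (hf : Integrable f ρ) (h : ∀ᵐ x ∂ρ, 0 < f x) : 0 < ∫ x, f x ∂ρ := by
  have h0 : 0 ≤ᵐ[ρ] f := h.mono fun x hx => hx.le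
  refine lt_of_le_of_ne (integral_nonneg_of_ae h0) fun h1 => ?_
  rw [eq_comm, integral_eq_zero_iff_of_nonneg_ae h0 hf] at h1
  obtain ⟨x, hx, hx'⟩ := (h.and h1).exists
  exact hx.ne' hx'

theorem transPDF_nonneg (hj0 : ∀ w v, 0 < j w v) (v v' : α) : 0 ≤ transPDF j μ η v v' :=
  integral_nonneg fun _ => mul_nonneg
    (div_nonneg (hj0 _ _).le (integral_nonneg fun _ => (hj0 _ _).le))
    (div_nonneg (hj0 _ _).le (integral_nonneg fun _ => (hj0 _ _).le))

theorem marginalPDF_nonneg (hj0 : ∀ w v, 0 < j w v) (v : α) : 0 ≤ marginalPDF j μ η v :=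
  div_nonneg (integral_nonneg fun _ => (hj0 _ _).le)
    (integral_nonneg fun _ => integral_nonneg fun _ => (hj0 _ _).le)

/-- The marginal of `v` cancels, and up to the normalizing constant both sides are the integral over
w of `j w v * j w v' / ∫ u, j w u ∂μ`, symmetric in `v` and `v'`. -/
theorem detailed_balance [NeZero η] (hj0 : ∀ w v, 0 < j w v) (hj : ∀ v, Integrable (j · v) η)
    (v v' : α) : marginalPDF j μ η v * transPDF j μ η v v'
      = marginalPDF j μ η v' * transPDF j μ η v' v := by
  unfold marginalPDF transPDF
  rw [← integral_const_mul, ← integral_const_mul]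
  refine integral_congr_ae (Filter.Eventually.of_forall fun w => ?_)
  have h1 := (integral_pos_of_pos (hj v) (Filter.Eventually.of_forall fun w => hj0 w v)).ne'
  have h2 := (integral_pos_of_pos (hj v') (Filter.Eventually.of_forall fun w => hj0 w v')).ne'
  simp only
  field_simp

theorem lintegral_marginalPDF [NeZero μ] [NeZero η] (hj0 : ∀ w v, 0 < j w v)
    (hj : ∀ v, Integrable (j · v) η) (hd : Integrable (fun v => ∫ w, j w v ∂η) μ) :
    ∫⁻ v, ENNReal.ofReal (marginalPDF j μ η v) ∂μ = 1 := by
  rw [← ofReal_integral_eq_lintegral_ofReal (f := marginalPDF j μ η) (hd.div_const _)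
    (Filter.Eventually.of_forall (marginalPDF_nonneg hj0))]
  unfold marginalPDF
  have hpos := integral_pos_of_pos hd (Filter.Eventually.of_forall fun v =>
    integral_pos_of_pos (hj v) (Filter.Eventually.of_forall fun w => hj0 w v))
  rw [integral_div, div_self hpos.ne', ENNReal.ofReal_one]

variable [SFinite μ] [SFinite η]

theorem integrable_uncurry (hjm : Measurable (Function.uncurry j)) (hj0 : ∀ w v, 0 < j w v)
    (hj : ∀ v, Integrable (j · v) η) (hd : Integrable (fun v => ∫ w, j w v ∂η) μ) :
    Integrable (Function.uncurry j) (η.prod μ) := by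
  rw [integrable_prod_iff' hjm.aestronglyMeasurable]
  refine ⟨Filter.Eventually.of_forall hj, hd.congr (Filter.Eventually.of_forall fun v => ?_)⟩
  exact integral_congr_ae (Filter.Eventually.of_forall fun w =>
    (Real.norm_of_nonneg (hj0 w v).le).symm)

/-- Sections in v are obtained from Fubini, hence only for almost every w, whereas `hj` holds for
every v. -/
theorem ae_integrable_left (hjm : Measurable (Function.uncurry j)) (hj0 : ∀ w v, 0 < j w v)
    (hj : ∀ v, Integrable (j · v) η) (hd : Integrable (fun v => ∫ w, j w v ∂η) μ) :
    ∀ᵐ w ∂η, Integrable (j w) μ :=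
  (integrable_uncurry hjm hj0 hj hd).prod_right_ae

section

variable [NeZero μ] (hjm : Measurable (Function.uncurry j)) (hj0 : ∀ w v, 0 < j w v)
  (hj : ∀ v, Integrable (j · v) η) (hd : Integrable (fun v => ∫ w, j w v ∂η) μ)

include hjm hj0 hj hd

/-- The integrand is the joint density of the two half-steps of the sampler from `v`. Integrating
out the new v first leaves the conditional density of w. -/
theorem integrable_step (v : α) : Integrable (fun z : β × α =>
    (j z.1 z.2 / ∫ u, j z.1 u ∂μ) * (j z.1 v / ∫ w', j w' v ∂η)) (η.prod μ) := by
  have h1 : Measurable fun w => ∫ u, j w u ∂μ :=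
    (StronglyMeasurable.integral_prod_right' hjm.stronglyMeasurable).measurable
  have hm : Measurable fun z : β × α =>
      (j z.1 z.2 / ∫ u, j z.1 u ∂μ) * (j z.1 v / ∫ w', j w' v ∂η) :=
    (hjm.div (h1.comp measurable_fst)).mul
      ((hjm.comp (measurable_fst.prodMk measurable_const)).div_const _)
  rw [integrable_prod_iff hm.aestronglyMeasurable]
  have hae := ae_integrable_left hjm hj0 hj hd
  refine ⟨hae.mono fun w hw => (hw.div_const (∫ u, j w u ∂μ)).mul_const (j w v / ∫ w', j w' v ∂η),
    ((hj v).div_const (∫ w', j w' v ∂η)).congr ?_⟩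
  filter_upwards [hae] with w hw
  have hpos := integral_pos_of_pos hw (Filter.Eventually.of_forall fun v => hj0 w v)
  have hnn : ∀ v', 0 ≤ (j w v' / ∫ u, j w u ∂μ) * (j w v / ∫ w', j w' v ∂η) := fun v' =>
    mul_nonneg (div_nonneg (hj0 _ _).le hpos.le)
      (div_nonneg (hj0 _ _).le (integral_nonneg fun _ => (hj0 _ _).le))
  simp_rw [Real.norm_of_nonneg (hnn _)]
  rw [integral_mul_const, integral_div, div_self hpos.ne', one_mul]

theorem integrable_transPDF (v : α) : Integrable (transPDF j μ η v) μ :=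
  (integrable_step hjm hj0 hj hd v).integral_prod_right

theorem integral_transPDF [NeZero η] (v : α) : ∫ v', transPDF j μ η v v' ∂μ = 1 := by
  unfold transPDF
  rw [← integral_integral_swap (integrable_step hjm hj0 hj hd v)]
  have hpos := integral_pos_of_pos (hj v) (Filter.Eventually.of_forall fun w => hj0 w v)
  calc _ = ∫ w, j w v / ∫ w', j w' v ∂η ∂η := by
        refine integral_congr_ae ?_
        filter_upwards [ae_integrable_left hjm hj0 hj hd] with w hw
        have hw0 := integral_pos_of_pos hw (Filter.Eventually.of_forall fun v => hj0 w v)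
        rw [integral_mul_const, integral_div, div_self hw0.ne', one_mul]
    _ = 1 := by rw [integral_div, div_self hpos.ne']

theorem lintegral_transPDF [NeZero η] (v : α) :
    ∫⁻ v', ENNReal.ofReal (transPDF j μ η v v') ∂μ = 1 := by
  rw [← ofReal_integral_eq_lintegral_ofReal (integrable_transPDF hjm hj0 hj hd v)
    (Filter.Eventually.of_forall (transPDF_nonneg hj0 v)), integral_transPDF hjm hj0 hj hd,
    ENNReal.ofReal_one]

/-- For exceptional `v'` the integrand in w might fail to be integrable, and the integral would then
be 0 by convention; hence only almost everywhere. -/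
theorem ae_transPDF_pos [NeZero η] (v : α) : ∀ᵐ v' ∂μ, 0 < transPDF j μ η v v' := by
  filter_upwards [(integrable_step hjm hj0 hj hd v).prod_left_ae] with v' hv'
  refine integral_pos_of_pos hv' ?_
  filter_upwards [ae_integrable_left hjm hj0 hj hd] with w hw
  have hw0 := integral_pos_of_pos hw (Filter.Eventually.of_forall fun v => hj0 w v)
  have hv0 := integral_pos_of_pos (hj v) (Filter.Eventually.of_forall fun w => hj0 w v)
  exact mul_pos (div_pos (hj0 _ _) hw0) (div_pos (hj0 _ _) hv0)

end

end DataAugmentation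

/-! ### Integrability of the joint density -/

theorem gigKernel_pos (p a b : ℝ) {x : ℝ} (hx : 0 < x) : 0 < gigKernel p a b x :=
  mul_pos (Real.rpow_pos_of_pos hx _) (Real.exp_pos _)

theorem continuousOn_gigKernel (p a b : ℝ) : ContinuousOn (gigKernel p a b) (Set.Ioi 0) := by
  intro x hx
  have hx' : x ≠ 0 := (Set.mem_Ioi.1 hx).ne'
  refine ContinuousAt.continuousWithinAt ?_
  unfold gigKernel
  refine (Real.continuousAt_rpow_const _ _ (Or.inl hx')).mul ?_
  fun_prop (disch := assumption)

/-- `exp (-c y)` is dominated by every negative power of `y`. -/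
theorem exp_neg_mul_le {c y : ℝ} (hc : 0 < c) (hy : 0 < y) (N : ℕ) :
    Real.exp (-(c * y)) ≤ (N.factorial / c ^ N) * y ^ (-(N : ℝ)) := by
  have h := Real.pow_div_factorial_le_exp _ (mul_pos hc hy).le N
  rw [Real.exp_neg, Real.rpow_neg hy.le, Real.rpow_natCast]
  calc (Real.exp (c * y))⁻¹ ≤ ((c * y) ^ N / N.factorial)⁻¹ := by
        gcongr
    _ = _ := by rw [mul_pow]; field_simp

theorem gigKernel_le_of_pos_a {p a b x : ℝ} (ha : 0 < a) (hb : 0 ≤ b) (hx : 0 < x) (N : ℕ) :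
    gigKernel p a b x ≤ (N.factorial / (a / 2) ^ N) * x ^ (p - 1 - N) := by
  unfold gigKernel
  calc x ^ (p - 1) * Real.exp (-(1 / 2) * (a * x + b / x))
      ≤ x ^ (p - 1) * Real.exp (-(a / 2 * x)) := by
        gcongr
        have : 0 ≤ b / x := by positivity
        linarith
    _ ≤ x ^ (p - 1) * ((N.factorial / (a / 2) ^ N) * x ^ (-(N : ℝ))) := by
        gcongr
        exact exp_neg_mul_le (by positivity) hx N
    _ = _ := by rw [sub_eq_add_neg (p - 1), Real.rpow_add hx]; ring

theorem gigKernel_le_of_pos_b {p a b x : ℝ} (ha : 0 ≤ a) (hb : 0 < b) (hx : 0 < x) (N : ℕ) :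
    gigKernel p a b x ≤ (N.factorial / (b / 2) ^ N) * x ^ (p - 1 + N) := by
  unfold gigKernel
  calc x ^ (p - 1) * Real.exp (-(1 / 2) * (a * x + b / x))
      ≤ x ^ (p - 1) * Real.exp (-(b / 2 * x⁻¹)) := by
        gcongr
        have : 0 ≤ a * x := by positivity
        rw [div_eq_mul_inv b x]
        linarith
    _ ≤ x ^ (p - 1) * ((N.factorial / (b / 2) ^ N) * x⁻¹ ^ (-(N : ℝ))) := by
        gcongr
        exact exp_neg_mul_le (by positivity) (inv_pos.2 hx) N
    _ = _ := by rw [Real.rpow_add hx, Real.inv_rpow hx.le, Real.rpow_neg hx.le, inv_inv]; ring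

theorem gigKernel_le_rpow {p a b x : ℝ} (ha : 0 ≤ a) (hb : 0 ≤ b) (hx : 0 < x) :
    gigKernel p a b x ≤ 1 * x ^ (p - 1) := by
  unfold gigKernel
  rw [mul_comm]
  gcongr
  rw [Real.exp_le_one_iff]
  have : 0 ≤ a * x + b / x := by positivity
  linarith

/-- Comparison with powers on either side of 1. Near 0 either `0 < p` suffices or `0 < b` supplies
any power; near infinity either `p < 0` suffices or `0 < a` does. The parameter space is what
guarantees both alternatives. -/
theorem integrableOn_gigKernel {p a b : ℝ} (h : IsGIGParam p a b) :
    IntegrableOn (gigKernel p a b) (Set.Ioi 0) := by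
  have ha : 0 ≤ a := by
    rcases h with h | h | h
    exacts [h.1.le, h.1.ge, h.1.le]
  have hb : 0 ≤ b := by
    rcases h with h | h | h
    exacts [h.2.le, h.2.1.le, h.2.1.ge]
  have hm : ∀ s ⊆ Set.Ioi (0 : ℝ), MeasurableSet s →
      AEStronglyMeasurable (gigKernel p a b) (volume.restrict s) := fun s hs hsm =>
    ((continuousOn_gigKernel p a b).mono hs).aestronglyMeasurable hsm
  have hnorm : ∀ x, 0 < x → ‖gigKernel p a b x‖ = gigKernel p a b x := fun x hx =>
    Real.norm_of_nonneg (gigKernel_pos p a b hx).le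
  rw [← Set.Ioc_union_Ioi_eq_Ioi zero_le_one, integrableOn_union]
  constructor
  · obtain ⟨C, r, hr, hC⟩ : ∃ C r : ℝ, -1 < r ∧ ∀ x, 0 < x → gigKernel p a b x ≤ C * x ^ r := by
      by_cases hp : 0 < p
      · exact ⟨1, p - 1, by linarith, fun x hx => gigKernel_le_rpow ha hb hx⟩
      · have hb' : 0 < b := by
          rcases h with h | h | h
          exacts [h.2, h.2.1, absurd h.2.2 hp]
        obtain ⟨N, hN⟩ := exists_nat_gt (-p)
        exact ⟨_, p - 1 + N, by linarith, fun x hx => gigKernel_le_of_pos_b ha hb' hx N⟩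
    have hi : IntegrableOn (fun x : ℝ => C * x ^ r) (Set.Ioc 0 1) :=
      ((intervalIntegrable_iff_integrableOn_Ioc_of_le zero_le_one).1
        (intervalIntegral.intervalIntegrable_rpow' hr)).const_mul C
    refine hi.mono' (hm _ Set.Ioc_subset_Ioi_self measurableSet_Ioc) ?_
    filter_upwards [ae_restrict_mem measurableSet_Ioc] with x hx
    rw [hnorm x hx.1]
    exact hC x hx.1
  · obtain ⟨C, r, hr, hC⟩ : ∃ C r : ℝ, r < -1 ∧ ∀ x, 0 < x → gigKernel p a b x ≤ C * x ^ r := by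
      by_cases hp : p < 0
      · exact ⟨1, p - 1, by linarith, fun x hx => gigKernel_le_rpow ha hb hx⟩
      · have ha' : 0 < a := by
          rcases h with h | h | h
          exacts [h.1, absurd h.2.2 hp, h.1]
        obtain ⟨N, hN⟩ := exists_nat_gt p
        exact ⟨_, p - 1 - N, by linarith, fun x hx => gigKernel_le_of_pos_a ha' hb hx N⟩
    have hi : IntegrableOn (fun x : ℝ => C * x ^ r) (Set.Ioi 1) :=
      (integrableOn_Ioi_rpow_of_lt hr one_pos).const_mul C
    refine hi.mono' (hm _ (Set.Ioi_subset_Ioi zero_le_one) measurableSet_Ioi) ?_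
    filter_upwards [ae_restrict_mem measurableSet_Ioi] with x hx
    have hx0 : 0 < x := one_pos.trans hx
    rw [hnorm x hx0]
    exact hC x hx0

theorem gigPDF_pos {p a b x : ℝ} (h : IsGIGParam p a b) (hx : 0 < x) : 0 < gigPDF p a b x := by
  have : NeZero ((volume : Measure ℝ).restrict (Set.Ioi 0)) := ⟨by simp⟩
  refine div_pos (gigKernel_pos p a b hx)
    (DataAugmentation.integral_pos_of_pos (integrableOn_gigKernel h) ?_)
  filter_upwards [ae_restrict_mem measurableSet_Ioi] with t ht using gigKernel_pos p a b ht

theorem gaussianPDFReal_le (m : ℝ) (s : NNReal) (x : ℝ) :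
    gaussianPDFReal m s x ≤ (√(2 * Real.pi * s))⁻¹ := by
  unfold gaussianPDFReal
  refine mul_le_of_le_one_right (by positivity) ?_
  rw [Real.exp_le_one_iff, neg_div]
  exact neg_nonpos.2 (by positivity)

/-! ### Lebesgue measure on the positive orthant -/

namespace PosOrthant

theorem neZero_volume (n : ℕ) : NeZero (volume : Measure (PosOrthant n)) := by
  refine ⟨fun h => ?_⟩
  have e : MeasurableEmbedding (Subtype.val : PosOrthant n → Fin n → ℝ) :=
    MeasurableEmbedding.subtype_coe (PosOrthant.measurableSet n)
  have h1 : (volume : Measure (PosOrthant n)) Set.univ = 0 := by rw [h]; rfl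
  change Measure.comap Subtype.val volume _ = 0 at h1
  rw [e.comap_apply, Set.image_univ] at h1
  erw [Subtype.range_coe] at h1
  have ho : IsOpen {v : Fin n → ℝ | ∀ i, 0 < v i} := by
    rw [Set.ofPred_forall]
    exact isOpen_iInter_of_finite fun i => isOpen_lt continuous_const (continuous_apply i)
  exact (ho.measure_pos volume ⟨fun _ => 1, fun _ => one_pos⟩).ne' h1

theorem integrable_prod {n : ℕ} {f : ℝ → ℝ} (hf : IntegrableOn f (Set.Ioi 0)) :
    Integrable fun v : PosOrthant n => ∏ i, f (v.1 i) := by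
  have e : MeasurableEmbedding (Subtype.val : PosOrthant n → Fin n → ℝ) :=
    MeasurableEmbedding.subtype_coe (PosOrthant.measurableSet n)
  have h1 : Integrable fun v : Fin n → ℝ => ∏ i, (Set.Ioi (0 : ℝ)).indicator f (v i) :=
    Integrable.fintype_prod fun _ => (integrable_indicator_iff measurableSet_Ioi).2 hf
  have h2 : Integrable (fun v : Fin n → ℝ => ∏ i, (Set.Ioi (0 : ℝ)).indicator f (v i))
      ((volume : Measure (PosOrthant n)).map Subtype.val) := by
    change Integrable _ ((Measure.comap Subtype.val volume).map Subtype.val)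
    rw [e.map_comap]
    exact h1.restrict
  refine (e.integrable_map_iff.1 h2).congr (Filter.Eventually.of_forall fun v => ?_)
  exact Finset.prod_congr rfl fun i _ => Set.indicator_of_mem (v.2 i) f

end PosOrthant

/-! ### Positivity and integrability in the model -/

namespace LLnGM

variable {m n q : ℕ} (M : LLnGM m n q)

theorem likelihood_pos (w : Fin n → ℝ) : 0 < M.likelihood w :=
  Finset.prod_pos fun _ _ => gaussianPDFReal_pos _ _ _
    (Real.toNNReal_pos.2 (pow_pos M.σε_pos 2)).ne'

theorem latentPDF_pos (w : Fin n → ℝ) (v : PosOrthant n) : 0 < M.latentPDF w v :=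
  mul_pos (abs_pos.2 M.K_det_ne_zero) (Finset.prod_pos fun i _ => gaussianPDFReal_pos _ _ _
    (Real.toNNReal_pos.2 (mul_pos (pow_pos M.σ_pos 2) (v.2 i))).ne')

theorem priorPDF_pos (v : PosOrthant n) : 0 < M.priorPDF v :=
  Finset.prod_pos fun i _ => gigPDF_pos M.gig_param (v.2 i)

theorem joint_pos (w : Fin n → ℝ) (v : PosOrthant n) : 0 < M.joint w v :=
  mul_pos (mul_pos (M.likelihood_pos w) (M.latentPDF_pos w v)) (M.priorPDF_pos v)

theorem integrable_priorPDF : Integrable M.priorPDF :=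
  PosOrthant.integrable_prod ((integrableOn_gigKernel M.gig_param).div_const _)

theorem exists_likelihood_le : ∃ C, 0 ≤ C ∧ ∀ w, M.likelihood w ≤ C :=
  ⟨∏ _j : Fin m, (√(2 * Real.pi * (M.σε ^ 2).toNNReal))⁻¹, by positivity, fun _ =>
    Finset.prod_le_prod (fun _ _ => gaussianPDFReal_nonneg _ _ _)
      fun _ _ => gaussianPDFReal_le _ _ _⟩

/-- The change of variables w ↦ K w turns the density into a product of Gaussians, its Jacobian
cancelling `|M.K.det|`. -/
theorem integrable_latentPDF_and_integral (v : PosOrthant n) :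
    Integrable (fun w => M.latentPDF w v) ∧ ∫ w, M.latentPDF w v = 1 := by
  set g : (Fin n → ℝ) → ℝ := fun x => ∏ i,
    gaussianPDFReal (M.μ * v.1 i - M.μ * M.h i) (M.σ ^ 2 * v.1 i).toNNReal (x i) with hg
  have hgi : Integrable g := Integrable.fintype_prod fun i => integrable_gaussianPDFReal _ _
  have hg1 : ∫ x, g x = 1 := by
    rw [hg, integral_fintype_prod_volume_eq_prod]
    exact Finset.prod_eq_one fun i _ => integral_gaussianPDFReal_eq_one _
      (Real.toNNReal_pos.2 (mul_pos (pow_pos M.σ_pos 2) (v.2 i))).ne'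
  have hmap := Real.map_matrix_volume_pi_eq_smul_volume_pi M.K_det_ne_zero
  have hL : Measurable (Matrix.toLin' M.K) := (LinearMap.continuous_on_pi _).measurable
  have hgmap : Integrable g (Measure.map (Matrix.toLin' M.K) volume) := by
    rw [hmap]
    exact hgi.smul_measure ENNReal.ofReal_ne_top
  have hcomp : Integrable (fun w => g (M.K.mulVec w)) := hgmap.comp_measurable hL
  refine ⟨hcomp.const_mul _, ?_⟩
  have hint : ∫ w, g (M.K.mulVec w) = |M.K.det⁻¹| := by
    have h := integral_map hL.aemeasurable hgmap.1
    rw [hmap, integral_smul_measure, hg1, ENNReal.toReal_ofReal (abs_nonneg _)] at h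
    simpa using h.symm
  unfold latentPDF
  rw [integral_const_mul]
  change |M.K.det| * ∫ w, g (M.K.mulVec w) = 1
  rw [hint, abs_inv, mul_inv_cancel₀ (abs_pos.2 M.K_det_ne_zero).ne']

theorem measurable_joint_left (v : PosOrthant n) : Measurable fun w => M.joint w v :=
  Measurable.comp (g := fun z : (Fin n → ℝ) × PosOrthant n => M.joint z.1 z.2)
    (f := fun w => (w, v)) M.measurable_joint measurable_prodMk_right

theorem joint_le {C : ℝ} (hC : ∀ w, M.likelihood w ≤ C) (w : Fin n → ℝ) (v : PosOrthant n) :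
    M.joint w v ≤ C * M.latentPDF w v * M.priorPDF v :=
  mul_le_mul_of_nonneg_right (mul_le_mul_of_nonneg_right (hC w) (M.latentPDF_pos w v).le)
    (M.priorPDF_pos v).le

theorem integrable_joint_left (v : PosOrthant n) : Integrable fun w => M.joint w v := by
  obtain ⟨C, -, hC⟩ := M.exists_likelihood_le
  refine (((M.integrable_latentPDF_and_integral v).1.const_mul C).mul_const (M.priorPDF v)).mono'
    (M.measurable_joint_left v).aestronglyMeasurable (Filter.Eventually.of_forall fun w => ?_)
  rw [Real.norm_of_nonneg (M.joint_pos w v).le]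
  exact M.joint_le hC w v

theorem measurable_integral_joint : Measurable fun v => ∫ w, M.joint w v :=
  (StronglyMeasurable.integral_prod_left' M.measurable_joint.stronglyMeasurable).measurable

/-- The likelihood is bounded uniformly in w and the latent density has mass 1, so a multiple of the
prior dominates. -/
theorem integrable_integral_joint : Integrable fun v => ∫ w, M.joint w v := by
  obtain ⟨C, -, hC⟩ := M.exists_likelihood_le
  refine (M.integrable_priorPDF.const_mul C).mono'
    M.measurable_integral_joint.aestronglyMeasurable (Filter.Eventually.of_forall fun v => ?_)
  rw [Real.norm_of_nonneg (integral_nonneg fun w => (M.joint_pos w v).le)]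
  obtain ⟨hi, h1⟩ := M.integrable_latentPDF_and_integral v
  refine (integral_mono (M.integrable_joint_left v) ((hi.const_mul C).mul_const (M.priorPDF v))
    fun w => M.joint_le hC w v).trans_eq ?_
  rw [integral_mul_const, integral_const_mul, h1, mul_one]

/-! ### The Gibbs sampler as a reversible Markov kernel -/

theorem kernel_apply (v : PosOrthant n) :
    M.kernel v = volume.withDensity fun v' => ENNReal.ofReal (M.k v v') := rfl

/-- By definition `k` is `transPDF` of `joint`, as `posteriorPDF` is its `marginalPDF`, so the data
augmentation results apply verbatim. -/
theorem k_nonneg (v v' : PosOrthant n) : 0 ≤ M.k v v' :=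
  DataAugmentation.transPDF_nonneg M.joint_pos v v'

theorem lintegral_k (v : PosOrthant n) : ∫⁻ v', ENNReal.ofReal (M.k v v') = 1 :=
  have := PosOrthant.neZero_volume n
  DataAugmentation.lintegral_transPDF M.measurable_joint M.joint_pos M.integrable_joint_left
    M.integrable_integral_joint v

instance isMarkovKernel_kernel : IsMarkovKernel M.kernel :=
  ⟨fun v => ⟨by rw [kernel_apply, withDensity_apply _ MeasurableSet.univ, setLIntegral_univ,
    M.lintegral_k]⟩⟩

instance isProbabilityMeasure_posterior : IsProbabilityMeasure M.posterior :=
  ⟨by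
    have := PosOrthant.neZero_volume n
    rw [posterior, withDensity_apply _ MeasurableSet.univ, setLIntegral_univ]
    exact DataAugmentation.lintegral_marginalPDF M.joint_pos
      M.integrable_joint_left M.integrable_integral_joint⟩

theorem invariant_posterior : M.kernel.Invariant M.posterior :=
  MarkovL2.invariant_of_detailed_balance M.measurable_k (M.measurable_integral_joint.div_const _)
    (DataAugmentation.marginalPDF_nonneg M.joint_pos) M.kernel_apply M.lintegral_k
    (DataAugmentation.detailed_balance M.joint_pos M.integrable_joint_left)

theorem measurable_k_right (v : PosOrthant n) : Measurable (M.k v) :=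
  Measurable.comp (g := Function.uncurry M.k) (f := fun v' => (v, v')) M.measurable_k
    measurable_prodMk_left

theorem measurable_ofReal_k (v : PosOrthant n) : Measurable fun v' => ENNReal.ofReal (M.k v v') :=
  (M.measurable_k_right v).ennreal_ofReal

/-- Almost everywhere positivity of `k v` makes the transition law dominate Lebesgue measure, hence
the posterior. This is the hypothesis `hdom` of the equality case in Jensen. -/
theorem posterior_absolutelyContinuous_kernel (v : PosOrthant n) : M.posterior ≪ M.kernel v := by
  have := PosOrthant.neZero_volume n
  refine (withDensity_absolutelyContinuous _ _).trans (withDensity_absolutelyContinuous'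
    (M.measurable_ofReal_k v).aemeasurable ?_)
  filter_upwards [DataAugmentation.ae_transPDF_pos M.measurable_joint M.joint_pos
    M.integrable_joint_left M.integrable_integral_joint v] with v' hv'
  exact (ENNReal.ofReal_pos.2 hv').ne'

theorem integrable_kernel_iff (v : PosOrthant n) (f : PosOrthant n → ℝ) :
    Integrable f (M.kernel v) ↔ Integrable fun v' => M.k v v' * f v' := by
  rw [kernel_apply, integrable_withDensity_iff_integrable_smul'
    (M.measurable_ofReal_k v)
    (Filter.Eventually.of_forall fun _ => ENNReal.ofReal_lt_top)]
  simp_rw [ENNReal.toReal_ofReal (M.k_nonneg v _), smul_eq_mul]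

theorem integral_kernel (v : PosOrthant n) (f : PosOrthant n → ℝ) :
    ∫ v', f v' ∂M.kernel v = ∫ v', M.k v v' * f v' := by
  rw [kernel_apply, integral_withDensity_eq_integral_toReal_smul
    (M.measurable_ofReal_k v)
    (Filter.Eventually.of_forall fun _ => ENNReal.ofReal_lt_top)]
  simp_rw [ENNReal.toReal_ofReal (M.k_nonneg v _), smul_eq_mul]

/-- The integrability clause is automatic: f is square integrable under almost every transition law,
which is a probability measure. -/
theorem isMarkovOperator_iff (Λ : Lp ℝ 2 M.posterior →L[ℝ] Lp ℝ 2 M.posterior) :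
    M.IsMarkovOperator Λ ↔ MarkovL2.IsKernelOperator M.kernel Λ := by
  refine forall_congr' fun f => ⟨fun h => ?_, fun h => ?_⟩
  · filter_upwards [h] with v hv
    rw [hv.2, M.integral_kernel]
  · filter_upwards [h, MarkovL2.ae_memLp_kernel M.invariant_posterior (Lp.memLp f)] with v hv hf
    rw [← M.integral_kernel, ← M.integrable_kernel_iff]
    exact ⟨hf.integrable one_le_two, hv⟩

end LLnGM

theorem proposition2p4 {m n q : ℕ} (M : LLnGM m n q) :
    (∃! Λ : Lp ℝ 2 M.posterior →L[ℝ] Lp ℝ 2 M.posterior, M.IsMarkovOperator Λ) ∧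
    ∀ Λ : Lp ℝ 2 M.posterior →L[ℝ] Lp ℝ 2 M.posterior, M.IsMarkovOperator Λ →
      MarkovL2.IsTraceClass Λ →
        (0 < MarkovL2.spectralGap Λ ∧ MarkovL2.spectralGap Λ ≤ 1) ∧
        (∃ r : ℝ, r < 1 ∧ ∀ z ∈ spectrum ℝ Λ, z ≠ 1 → |z| ≤ r) ∧
        MarkovL2.GeometricallyErgodicL2 M.kernel M.posterior ∧
        ∀ ν : Measure (PosOrthant n), MarkovL2.IsL2Start M.posterior ν →
          ∃ C : ℝ, ∀ t : ℕ,
            MarkovL2.tvDist (MarkovL2.law M.kernel ν t) M.posterior ≤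
              C * (1 - MarkovL2.spectralGap Λ) ^ t := by
  have hinv := M.invariant_posterior
  simp_rw [M.isMarkovOperator_iff]
  refine ⟨?_, fun Λ hΛ htc => ?_⟩
  · obtain ⟨Λ, hΛ⟩ := MarkovL2.exists_isKernelOperator hinv
    refine ⟨Λ, hΛ, fun Λ' hΛ' => ?_⟩
    ext1 f
    exact Lp.ext ((hΛ' f).trans (hΛ f).symm)
  · have hgap := hΛ.spectralGap_pos hinv M.posterior_absolutelyContinuous_kernel htc
    have hnorm : 1 - MarkovL2.spectralGap Λ = ‖MarkovL2.restrictL2Zero Λ‖ := sub_sub_cancel _ _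
    -- The spectral radius bound and the convergence rate are both ‖Λ₀‖, and the constant is the
    -- L²(π) norm of dν/dπ. If ‖Λ₀‖ = 0, the case `t = 0` relies on 0 ^ 0 = 1.
    refine ⟨⟨hgap, sub_le_self _ (MarkovL2.restrictL2Zero Λ).opNorm_nonneg⟩,
      ⟨1 - MarkovL2.spectralGap Λ, sub_lt_self _ hgap, fun z hz hz1 => ?_⟩,
      hΛ.geometricallyErgodicL2 hinv hgap,
      fun ν hν => ⟨‖hν.2.2.toLp (fun x => (ν.rnDeriv M.posterior x).toReal)‖, fun t => ?_⟩⟩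
    · rw [hnorm]
      exact hΛ.abs_le_of_mem_spectrum hinv hz hz1
    · rw [hnorm]
      exact hΛ.tvDist_law_le hinv hν t
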